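/- For a group $\Gamma$ and an algebraically closed field $\mathbb F$ let $X(\Gamma)_{\mathbb F}$ be the variety of characters $\chi_\rho=\operatorname{tr}\circ\rho$ of representations $\rho:\Gamma\to\mathrm{SL}_2(\mathbb F)$, with the Zariski topology given by the coordinate functions $\tau_\gamma(\chi)=\chi(\gamma)$, $\gamma\in\Gamma$. A character is called irreducible if it is the character of an irreducible representation. For coprime positive integers $m,n$ let $\Gamma=\langle a,b\mid a^m=b^n\rangle$ be the group of the torus knot $T(m,n)$, and write $X(T(m,n))_{\mathbb F}=X(\Gamma)_{\mathbb F}$ and $X(T(m,n))=X(\Gamma)_{\mathbb C}$. Let $\mathbb F$ be an algebraically closed field of characteristic $p>2$, suppose that $p\mid n$, and write $n=p^r n'$ with $n'$ coprime to $p$. Then exactly $\frac{(m-1)(n-1)}2$ irreducible components of $X(T(m,n))$ contain irreducible characters, exactly $\frac{(m-1)(n'+1)}2$ irreducible components of $X(T(m,n))_{\mathbb F}$ contain irreducible characters, and the former collapse onto the latter under reduction mod $p$, in the following sense. Let $\overline{\mathbb Z}\subset\mathbb C$ be the ring of algebraic integers. There is a ring homomorphism $\varphi:\overline{\mathbb Z}\to\mathbb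 F$, and for every such $\varphi$ the reductions of the components of $X(T(m,n))$ that contain irreducible characters are precisely the components of $X(T(m,n))_{\mathbb F}$ that contain irreducible characters. Here the reduction of $C\subset X(T(m,n))$ is the set of points of $X(T(m,n))_{\mathbb F}$ at which $\varphi(f)$ vanishes for every polynomial $f$ over $\overline{\mathbb Z}$ in the coordinates $\tau_\gamma$ that vanishes on $C$. -/

import Mathlib

open scoped MatrixGroups

/-- The group of the torus knot `T(m,n)` (`m`, `n` coprime), i.e. the fundamental group of the
knot exterior, in its standard presentation `⟨a, b ∣ a ^ m = b ^ n⟩`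
(`a` is the generator `true`, `b` is the generator `false`). -/
abbrev TorusKnotGroup (m n : ℕ) : Type :=
  PresentedGroup ({FreeGroup.of true ^ m * (FreeGroup.of false ^ n)⁻¹} : Set (FreeGroup Bool))

/-- A homomorphism `Γ → SL₂(F)` viewed as a linear representation of `Γ` on `F²`. -/
def SL2Rep.toRepresentation {Γ F : Type*} [Group Γ] [Field F] (ρ : Γ →* SL(2, F)) :
    Representation F Γ (Fin 2 → F) where
  toFun γ := Matrix.toLin' (ρ γ : Matrix (Fin 2) (Fin 2) F)
  map_one' := by simp [Module.End.one_eq_id]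
  map_mul' γ δ := by simp [Matrix.toLin'_mul, Module.End.mul_eq_comp]

/-- `χ` is the character of `ρ : Γ → SL₂(F)`. -/
def IsSL2CharacterOf {Γ F : Type*} [Group Γ] [Field F] (χ : Γ → F) (ρ : Γ →* SL(2, F)) : Prop :=
  ∀ γ, χ γ = Matrix.trace (ρ γ : Matrix (Fin 2) (Fin 2) F)

/-- The character variety `X(Γ)_F`: the set of all characters of representations
`Γ → SL₂(F)`. (A structure, so that the only topology on it is the Zariski topology below.) -/
structure CharacterVariety (Γ F : Type*) [Group Γ] [Field F] where
  /-- the values of the character, i.e. all trace coordinates `τ_γ` of the point -/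
  val : Γ → F
  isCharacter : ∃ ρ : Γ →* SL(2, F), IsSL2CharacterOf val ρ

namespace CharacterVariety

/-- The algebraic subset of `X(Γ)_F` cut out by a set of polynomials in the trace
coordinates `τ_γ`, `γ ∈ Γ`. (For finitely generated `Γ` finitely many of these coordinates
generate all of them, so this agrees with the algebraic subsets in any of the usual
embeddings of `X(Γ)_F` in an affine space.) -/
def zeroSet {Γ F : Type*} [Group Γ] [Field F] (S : Set (MvPolynomial Γ F)) :
    Set (CharacterVariety Γ F) :=
  {χ | ∀ f ∈ S, MvPolynomial.eval χ.val f = 0}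

/-- The Zariski topology: the closed sets are the algebraic subsets. -/
instance zariski (Γ F : Type*) [Group Γ] [Field F] : TopologicalSpace (CharacterVariety Γ F) :=
  TopologicalSpace.ofClosed {Z | ∃ S : Set (MvPolynomial Γ F), Z = zeroSet S}
    ⟨{1}, by ext χ; simp [zeroSet]⟩
    (by
      intro A hA
      refine ⟨{f | ∃ S : Set (MvPolynomial Γ F), zeroSet S ∈ A ∧ f ∈ S}, ?_⟩
      ext χ
      constructor
      · rintro h f ⟨S, hS, hf⟩
        exact h _ hS f hf
      · intro h Z hZ
        obtain ⟨S, rfl⟩ := hA hZ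
        exact fun f hf => h f ⟨S, hZ, hf⟩)
    (by
      rintro _ ⟨S, rfl⟩ _ ⟨T, rfl⟩
      refine ⟨{f | ∃ g ∈ S, ∃ h ∈ T, f = g * h}, ?_⟩
      ext χ
      constructor
      · rintro (h | h) f ⟨g, hg, k, hk, rfl⟩
        · simp [h g hg]
        · simp [h k hk]
      · intro h
        by_contra hc
        simp only [Set.mem_union, not_or, zeroSet, Set.mem_ofPred_eq, not_forall] at hc
        obtain ⟨⟨g, hg, hg0⟩, ⟨k, hk, hk0⟩⟩ := hc
        have := h (g * k) ⟨g, hg, k, hk, rfl⟩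
        rw [map_mul] at this
        exact (mul_ne_zero hg0 hk0) this)

/-- An irreducible character: the character of an irreducible representation. -/
def IsIrreducibleCharacter {Γ F : Type*} [Group Γ] [Field F] (χ : CharacterVariety Γ F) : Prop :=
  ∃ ρ : Γ →* SL(2, F), IsSL2CharacterOf χ.val ρ ∧ (SL2Rep.toRepresentation ρ).IsIrreducible

/-- The irreducible components of `X(Γ)_F` that contain an irreducible character. -/
def irrCharComponents (Γ F : Type*) [Group Γ] [Field F] : Set (Set (CharacterVariety Γ F)) :=
  {C | C ∈ irreducibleComponents (CharacterVariety Γ F) ∧ ∃ χ ∈ C, χ.IsIrreducibleCharacter}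

/-- The reduction of a subset `Z` of `X(Γ)_ℂ` along a homomorphism `φ` from the ring of all
algebraic integers to a field `F`: the algebraic subset of `X(Γ)_F` defined by the reductions of
all polynomials with algebraic integer coefficients that vanish on `Z`. -/
def reduction {Γ F : Type*} [Group Γ] [Field F] (φ : integralClosure ℤ ℂ →+* F)
    (Z : Set (CharacterVariety Γ ℂ)) : Set (CharacterVariety Γ F) :=
  zeroSet {g | ∃ f : MvPolynomial Γ (integralClosure ℤ ℂ),
    (∀ χ ∈ Z, MvPolynomial.aeval χ.val f = 0) ∧ g = MvPolynomial.map φ f}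

end CharacterVariety

/-! If `ρ` is irreducible, then `A = ρ a` and `B = ρ b` do not commute, while `A ^ m = B ^ n`
commutes with both. By Cayley–Hamilton, `A ^ m` is a combination of `A` and `1` whose coefficients
are the Chebyshev values `S (m - 1)` and `-S (m - 2)` at `tr A` (`Matrix.pow_eq_chebyshev`). Hence
`S (m - 1)` vanishes at `tr A`, `S (n - 1)` vanishes at `tr B`, and the scalars, both `±1`, agree.
Conversely, any such pair of traces occurs with every value of `tr (A * B)`, through explicit
matrices.

The traces of `a`, `b`, `a * b` determine the character polynomially, so fixing such a pair cuts out
an irreducible closed line. These finitely many lines and the closed locus of reducible characters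
cover the variety, and each line contains an irreducible character. The lines are therefore the
required components (`irrCharComponents_eq_image_traceLine`).

Counting components is counting pairs of roots with equal signs, which is half of all pairs: for odd
`m`, negating the first root flips its sign. When `k` and `2` are invertible, `S (k - 1)` has `k -
1` simple roots. In characteristic `p`, the roots for `p ^ r * n'` are those for `n'` together with
`2` and `-2`, so `n - 1` drops to `n' + 1`.

For the reduction, complex roots are algebraic integers and every root in `F` lifts to one; signs
lift because `1 ≠ -1` in `F`. The trace polynomials have integer coefficients, so vanishing on a
complex line is an identity over the algebraic integers, to which `φ` applies
(`reduction_traceLine`). -/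

open Matrix

/-! ### Cayley–Hamilton identities for two-by-two matrices. -/

section TwoByTwo

variable {R : Type*} [CommRing R]

theorem Matrix.mul_self_eq_trace_smul_sub_det_smul (A : Matrix (Fin 2) (Fin 2) R) :
    A * A = A.trace • A - A.det • (1 : Matrix (Fin 2) (Fin 2) R) := by
  ext i j
  fin_cases i <;> fin_cases j <;>
    simp [Matrix.mul_apply, Fin.sum_univ_two, trace_fin_two, det_fin_two] <;> ring

theorem Matrix.mul_add_mul_swap (A B : Matrix (Fin 2) (Fin 2) R) :
    A * B + B * A = B.trace • A + A.trace • B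
      + ((A * B).trace - A.trace * B.trace) • (1 : Matrix (Fin 2) (Fin 2) R) := by
  ext i j
  fin_cases i <;> fin_cases j <;>
    simp [Matrix.mul_apply, Fin.sum_univ_two, trace_fin_two] <;> ring

/-- For invertible `A` this is Cayley–Hamilton for `A * B` multiplied on the left by `A⁻¹`. It keeps
the span of `1`, `A`, `B`, `A * B` stable under left multiplication by `B`. -/
theorem Matrix.mul_mul_self_of_det_eq_one {A B : Matrix (Fin 2) (Fin 2) R} (hB : B.det = 1) :
    B * (A * B) = A + (A * B).trace • B - A.trace • (1 : Matrix (Fin 2) (Fin 2) R) := by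
  rw [det_fin_two] at hB
  ext i j
  fin_cases i <;> fin_cases j <;>
    simp [Matrix.mul_apply, Fin.sum_univ_two, trace_fin_two]
  · linear_combination (-A 1 1) * hB
  · linear_combination (A 0 1) * hB
  · linear_combination (A 1 0) * hB
  · linear_combination (-A 0 0) * hB

/-- The Fricke polynomial: on the traces of `A`, `B`, `A * B` in `SL₂` it takes the value
`tr [A, B] - 2`. -/
def frickeKappa (x y z : R) : R := x ^ 2 + y ^ 2 + z ^ 2 - x * y * z - 4

/-- Makes irreducibility a polynomial condition on three traces: over an algebraically closed field
this determinant vanishes exactly when `A` and `B` share an eigenvector. -/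
theorem Matrix.det_commutator_eq_neg_frickeKappa {A B : Matrix (Fin 2) (Fin 2) R}
    (hA : A.det = 1) (hB : B.det = 1) :
    (A * B - B * A).det = -frickeKappa A.trace B.trace (A * B).trace := by
  have h : (A * B - B * A).det = 4 * A.det * B.det - A.det * B.trace ^ 2 - B.det * A.trace ^ 2
      - (A * B).trace ^ 2 + A.trace * B.trace * (A * B).trace := by
    simp only [det_fin_two, trace_fin_two, Matrix.mul_apply, Fin.sum_univ_two, Matrix.sub_apply]
    ring
  rw [h, hA, hB, frickeKappa]
  ring

open Polynomial.Chebyshev in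
-- The Cayley–Hamilton relation `A ^ 2 = tr A • A - 1` is the recursion that defines `S`.
theorem Matrix.pow_eq_chebyshev {A : Matrix (Fin 2) (Fin 2) R} (hA : A.det = 1) (k : ℕ) :
    A ^ k = (S R ((k : ℤ) - 1)).eval A.trace • A
      - (S R ((k : ℤ) - 2)).eval A.trace • (1 : Matrix (Fin 2) (Fin 2) R) := by
  induction k with
  | zero => simp
  | succ k ih =>
    have h : S R (k : ℤ) = Polynomial.X * S R ((k : ℤ) - 1) - S R ((k : ℤ) - 2) := S_eq R k
    have e1 : ((k + 1 : ℕ) : ℤ) - 1 = k := by push_cast; ring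
    have e2 : ((k + 1 : ℕ) : ℤ) - 2 = k - 1 := by push_cast; ring
    rw [pow_succ, ih, sub_mul, smul_mul_assoc, smul_mul_assoc, one_mul,
      Matrix.mul_self_eq_trace_smul_sub_det_smul, hA, e1, e2, h]
    simp only [Polynomial.eval_sub, Polynomial.eval_mul, Polynomial.eval_X]
    module

end TwoByTwo

/-! ### Integral trace polynomials for two-generator groups. -/

section TracePolynomials

variable {Γ R : Type*} [Group Γ] [CommRing R]

theorem SL2Rep.coe_map_mul (ρ : Γ →* SL(2, R)) (γ δ : Γ) :
    (ρ (γ * δ) : Matrix (Fin 2) (Fin 2) R) = (ρ γ : Matrix (Fin 2) (Fin 2) R) * ρ δ :=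
  congrArg Subtype.val (map_mul ρ γ δ)

theorem SL2Rep.coe_map_inv (ρ : Γ →* SL(2, R)) (γ : Γ) :
    (ρ γ⁻¹ : Matrix (Fin 2) (Fin 2) R) = (ρ γ : Matrix (Fin 2) (Fin 2) R).adjugate :=
  congrArg Subtype.val (map_inv ρ γ)

/-- The traces of `ρ a`, `ρ b` and `ρ (a * b)`. -/
def traceTriple (a b : Γ) (ρ : Γ →* SL(2, R)) : Fin 3 → R :=
  ![trace (ρ a : Matrix (Fin 2) (Fin 2) R), trace (ρ b : Matrix (Fin 2) (Fin 2) R),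
    trace (ρ (a * b) : Matrix (Fin 2) (Fin 2) R)]

/-- `ρ γ` is the combination of `1`, `ρ a`, `ρ b` and `ρ a * ρ b` whose coefficients are the
polynomials `c i`, evaluated at the traces of `ρ a`, `ρ b` and `ρ (a * b)`. -/
def IsTraceCombination (a b : Γ) (ρ : Γ →* SL(2, R)) (γ : Γ)
    (c : Fin 4 → MvPolynomial (Fin 3) ℤ) : Prop :=
  (ρ γ : Matrix (Fin 2) (Fin 2) R) =
    MvPolynomial.aeval (traceTriple a b ρ) (c 0) • (1 : Matrix (Fin 2) (Fin 2) R)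
    + MvPolynomial.aeval (traceTriple a b ρ) (c 1) • (ρ a : Matrix (Fin 2) (Fin 2) R)
    + MvPolynomial.aeval (traceTriple a b ρ) (c 2) • (ρ b : Matrix (Fin 2) (Fin 2) R)
    + MvPolynomial.aeval (traceTriple a b ρ) (c 3) •
      ((ρ a : Matrix (Fin 2) (Fin 2) R) * (ρ b : Matrix (Fin 2) (Fin 2) R))

open MvPolynomial in
/-- The coefficients of `a * γ` in terms of those of `γ`. -/
noncomputable def leftMulCoeff (c : Fin 4 → MvPolynomial (Fin 3) ℤ) :
    Fin 4 → MvPolynomial (Fin 3) ℤ :=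
  ![-c 1, c 0 + X 0 * c 1, -c 3, c 2 + X 0 * c 3]

open MvPolynomial in
/-- The coefficients of `b * γ` in terms of those of `γ`. -/
noncomputable def rightMulCoeff (c : Fin 4 → MvPolynomial (Fin 3) ℤ) :
    Fin 4 → MvPolynomial (Fin 3) ℤ :=
  ![(X 2 - X 0 * X 1) * c 1 - c 2 - X 0 * c 3, X 1 * c 1 + c 3,
    c 0 + X 0 * c 1 + X 1 * c 2 + X 2 * c 3, -c 1]

variable {a b : Γ} {ρ : Γ →* SL(2, R)} {γ : Γ} {c : Fin 4 → MvPolynomial (Fin 3) ℤ}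

theorem isTraceCombination_one : IsTraceCombination a b ρ 1 ![1, 0, 0, 0] := by
  simp [IsTraceCombination]

theorem IsTraceCombination.left_mul (h : IsTraceCombination a b ρ γ c) :
    IsTraceCombination a b ρ (a * γ) (leftMulCoeff c) := by
  have hA := (ρ a).2
  have hAA := Matrix.mul_self_eq_trace_smul_sub_det_smul (ρ a : Matrix (Fin 2) (Fin 2) R)
  rw [hA] at hAA
  unfold IsTraceCombination at h ⊢
  rw [SL2Rep.coe_map_mul, h]
  simp only [mul_add, mul_smul_comm, ← mul_assoc, hAA, mul_one]
  simp [leftMulCoeff, traceTriple, sub_mul]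
  module

theorem IsTraceCombination.right_mul (h : IsTraceCombination a b ρ γ c) :
    IsTraceCombination a b ρ (b * γ) (rightMulCoeff c) := by
  have hB := (ρ b).2
  have hBB := Matrix.mul_self_eq_trace_smul_sub_det_smul (ρ b : Matrix (Fin 2) (Fin 2) R)
  have hBA := eq_sub_of_add_eq' (Matrix.mul_add_mul_swap (ρ a : Matrix (Fin 2) (Fin 2) R) (ρ b))
  have hBAB := Matrix.mul_mul_self_of_det_eq_one (A := (ρ a : Matrix (Fin 2) (Fin 2) R)) hB
  rw [hB] at hBB
  unfold IsTraceCombination at h ⊢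
  rw [SL2Rep.coe_map_mul, h]
  simp only [mul_add, mul_smul_comm, hBB, hBA, hBAB, mul_one]
  simp [rightMulCoeff, traceTriple]
  module

/-- In `SL₂` the inverse of `g` is `tr g - g`, so inverses need no new coefficients. -/
theorem IsTraceCombination.inv_mul {g : Γ} {d : Fin 4 → MvPolynomial (Fin 3) ℤ}
    (h : IsTraceCombination a b ρ γ c) (hd : IsTraceCombination a b ρ (g * γ) d) (i : Fin 3)
    (hi : traceTriple a b ρ i = trace (ρ g : Matrix (Fin 2) (Fin 2) R)) :
    IsTraceCombination a b ρ (g⁻¹ * γ) (fun j => MvPolynomial.X i * c j - d j) := by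
  have hg : (ρ g⁻¹ : Matrix (Fin 2) (Fin 2) R) = traceTriple a b ρ i • (1 : Matrix (Fin 2) (Fin 2) R)
      - (ρ g).1 := by
    rw [hi, SL2Rep.coe_map_inv, adjugate_fin_two]
    ext i j
    fin_cases i <;> fin_cases j <;> simp [trace_fin_two]
  unfold IsTraceCombination at h hd ⊢
  have e : (ρ (g⁻¹ * γ)).1 = traceTriple a b ρ i • (ρ γ).1 - (ρ (g * γ)).1 := by
    rw [SL2Rep.coe_map_mul, hg, sub_mul, smul_mul_assoc, one_mul, SL2Rep.coe_map_mul]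
  rw [e, h, hd]
  simp only [map_sub, map_mul, MvPolynomial.aeval_X]
  module

/-- In a group generated by `a` and `b`, the trace of `γ` in a representation in `SL₂` is an
integral polynomial, which does not depend on the representation, in the traces of `a`, `b` and
`a * b`. -/
theorem exists_tracePolynomial {K L : Type*} [CommRing K] [CommRing L]
    (hab : Subgroup.closure {a, b} = ⊤) (γ : Γ) :
    ∃ P : MvPolynomial (Fin 3) ℤ,
      (∀ ρ : Γ →* SL(2, K), trace (ρ γ : Matrix (Fin 2) (Fin 2) K)
        = MvPolynomial.aeval (traceTriple a b ρ) P) ∧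
      ∀ ρ : Γ →* SL(2, L), trace (ρ γ : Matrix (Fin 2) (Fin 2) L)
        = MvPolynomial.aeval (traceTriple a b ρ) P := by
  have key : ∃ c, (∀ ρ : Γ →* SL(2, K), IsTraceCombination a b ρ γ c) ∧
      ∀ ρ : Γ →* SL(2, L), IsTraceCombination a b ρ γ c := by
    have hγ : γ ∈ Subgroup.closure {a, b} := hab ▸ Subgroup.mem_top γ
    induction hγ using Subgroup.closure_induction_left with
    | one => exact ⟨_, fun _ => isTraceCombination_one, fun _ => isTraceCombination_one⟩
    | mul_left x hx y hy ih =>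
      obtain ⟨c, hK, hL⟩ := ih
      rcases hx with rfl | rfl
      · exact ⟨_, fun ρ => (hK ρ).left_mul, fun ρ => (hL ρ).left_mul⟩
      · exact ⟨_, fun ρ => (hK ρ).right_mul, fun ρ => (hL ρ).right_mul⟩
    | inv_mul_cancel x hx y hy ih =>
      obtain ⟨c, hK, hL⟩ := ih
      rcases hx with rfl | rfl
      · exact ⟨_, fun ρ => (hK ρ).inv_mul (hK ρ).left_mul 0 rfl,
          fun ρ => (hL ρ).inv_mul (hL ρ).left_mul 0 rfl⟩
      · exact ⟨_, fun ρ => (hK ρ).inv_mul (hK ρ).right_mul 1 rfl,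
          fun ρ => (hL ρ).inv_mul (hL ρ).right_mul 1 rfl⟩
  obtain ⟨c, hK, hL⟩ := key
  refine ⟨2 * c 0 + MvPolynomial.X 0 * c 1 + MvPolynomial.X 1 * c 2 + MvPolynomial.X 2 * c 3,
    fun ρ => ?_, fun ρ => ?_⟩
  · rw [hK ρ]
    simp [traceTriple, Matrix.trace_add, Matrix.trace_smul]
    ring
  · rw [hL ρ]
    simp [traceTriple, Matrix.trace_add, Matrix.trace_smul]
    ring

end TracePolynomials

/-! ### Irreducibility and the Fricke polynomial. -/

section Irreducible

variable {F : Type*} [Field F]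

theorem Matrix.exists_smul_eq_of_mulVec_eq_zero {M : Matrix (Fin 2) (Fin 2) F} (hM : M ≠ 0)
    {v w : Fin 2 → F} (hv : v ≠ 0) (hMv : M *ᵥ v = 0) (hMw : M *ᵥ w = 0) :
    ∃ c : F, w = c • v := by
  have hD : v 0 * w 1 - v 1 * w 0 = 0 := by
    by_contra hD
    apply hM
    have h1 : ∀ i, M i 0 * v 0 + M i 1 * v 1 = 0 := fun i => by
      simpa [mulVec, dotProduct, Fin.sum_univ_two] using congrFun hMv i
    have h2 : ∀ i, M i 0 * w 0 + M i 1 * w 1 = 0 := fun i => by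
      simpa [mulVec, dotProduct, Fin.sum_univ_two] using congrFun hMw i
    ext i j
    fin_cases j
    · refine (mul_eq_zero.mp (?_ : M i 0 * (v 0 * w 1 - v 1 * w 0) = 0)).resolve_right hD
      linear_combination w 1 * h1 i - v 1 * h2 i
    · refine (mul_eq_zero.mp (?_ : M i 1 * (v 0 * w 1 - v 1 * w 0) = 0)).resolve_right hD
      linear_combination v 0 * h2 i - w 0 * h1 i
  by_cases h0 : v 0 = 0
  · have h1 : v 1 ≠ 0 := by
      rintro h1
      exact hv (by ext i; fin_cases i <;> simp [h0, h1])
    refine ⟨w 1 / v 1, ?_⟩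
    have hw : w 0 = 0 := by simpa [h0, h1] using hD
    ext i
    fin_cases i <;> simp [h0, hw, h1]
  · refine ⟨w 0 / v 0, ?_⟩
    ext i
    fin_cases i <;> simp [h0]
    field_simp
    linear_combination hD

theorem Matrix.exists_eigenvector [IsAlgClosed F] (A : Matrix (Fin 2) (Fin 2) F) :
    ∃ v : Fin 2 → F, v ≠ 0 ∧ ∃ c : F, A *ᵥ v = c • v := by
  obtain ⟨c, hc⟩ := Module.End.exists_eigenvalue (Matrix.toLin' A)
  obtain ⟨v, hv⟩ := hc.exists_hasEigenvector
  exact ⟨v, hv.2, c, by simpa using hv.apply_eq_smul⟩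

theorem Matrix.exists_common_eigenvector_of_commute [IsAlgClosed F]
    {A B : Matrix (Fin 2) (Fin 2) F} (h : A * B = B * A) :
    ∃ v : Fin 2 → F, v ≠ 0 ∧ (∃ c : F, A *ᵥ v = c • v) ∧ ∃ d : F, B *ᵥ v = d • v := by
  obtain ⟨v, hv, c, hc⟩ := A.exists_eigenvector
  by_cases hA : A - c • (1 : Matrix (Fin 2) (Fin 2) F) = 0
  · obtain ⟨w, hw, d, hd⟩ := B.exists_eigenvector
    exact ⟨w, hw, ⟨c, by rw [sub_eq_zero.mp hA, smul_mulVec, one_mulVec]⟩, d, hd⟩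
  · refine ⟨v, hv, ⟨c, hc⟩, Matrix.exists_smul_eq_of_mulVec_eq_zero hA hv ?_ ?_⟩
    · rw [sub_mulVec, hc, smul_mulVec, one_mulVec, sub_self]
    · rw [sub_mulVec, mulVec_mulVec, h, ← mulVec_mulVec, hc, smul_mulVec, one_mulVec,
        mulVec_smul, sub_self]

/-- A nonzero commutator `N` of determinant zero has trace zero, so `N ^ 2 = 0` and its image is its
kernel, a line. Since `N * A` and `N * B` also have trace zero, `N * A * N` and `N * B * N` vanish,
so `A` and `B` preserve this line. -/
theorem Matrix.exists_common_eigenvector_of_det_commutator_eq_zero [IsAlgClosed F]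
    {A B : Matrix (Fin 2) (Fin 2) F} (h : (A * B - B * A).det = 0) :
    ∃ v : Fin 2 → F, v ≠ 0 ∧ (∃ c : F, A *ᵥ v = c • v) ∧ ∃ d : F, B *ᵥ v = d • v := by
  set N := A * B - B * A with hN
  by_cases hN0 : N = 0
  · exact Matrix.exists_common_eigenvector_of_commute (sub_eq_zero.mp hN0)
  have hsandwich : ∀ C : Matrix (Fin 2) (Fin 2) F, (N * C).trace = 0 → N * C * N = 0 := by
    intro C hC
    have : N * C * N = (N * C).trace • N - N.det • C.adjugate := by
      rw [adjugate_fin_two]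
      ext i j
      fin_cases i <;> fin_cases j <;>
        simp [Matrix.mul_apply, Fin.sum_univ_two, trace_fin_two, det_fin_two] <;> ring
    rw [this, hC, h, zero_smul, zero_smul, sub_zero]
  have hNN : N * 1 * N = 0 := hsandwich 1 (by
    rw [hN, mul_one, trace_sub, trace_mul_comm, sub_self])
  have hNA : N * A * N = 0 := hsandwich A (by
    rw [hN, sub_mul, trace_sub, trace_mul_comm (A * B), mul_assoc B, trace_mul_comm B, mul_assoc,
      sub_self])
  have hNB : N * B * N = 0 := hsandwich B (by
    rw [hN, sub_mul, trace_sub, trace_mul_comm (B * A), ← mul_assoc, mul_assoc, trace_mul_comm A,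
      trace_mul_comm (B * B), sub_self])
  obtain ⟨w, hw⟩ : ∃ w, N *ᵥ w ≠ 0 := by
    by_contra! hc
    exact hN0 (Matrix.ext_of_mulVec_single fun i => by rw [hc, zero_mulVec])
  have hv : N *ᵥ (N *ᵥ w) = 0 := by
    rw [mul_one] at hNN
    rw [mulVec_mulVec, hNN, zero_mulVec]
  refine ⟨N *ᵥ w, hw, ?_, ?_⟩
  · refine Matrix.exists_smul_eq_of_mulVec_eq_zero hN0 hw hv ?_
    rw [mulVec_mulVec, mulVec_mulVec, hNA, zero_mulVec]
  · refine Matrix.exists_smul_eq_of_mulVec_eq_zero hN0 hw hv ?_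
    rw [mulVec_mulVec, mulVec_mulVec, hNB, zero_mulVec]

theorem Matrix.det_commutator_eq_zero_of_common_eigenvector {A B : Matrix (Fin 2) (Fin 2) F}
    {v : Fin 2 → F} (hv : v ≠ 0) {c d : F} (hA : A *ᵥ v = c • v) (hB : B *ᵥ v = d • v) :
    (A * B - B * A).det = 0 := by
  refine Matrix.exists_mulVec_eq_zero_iff.mp ⟨v, hv, ?_⟩
  rw [sub_mulVec, ← mulVec_mulVec, ← mulVec_mulVec, hA, hB, mulVec_smul, mulVec_smul, hA, hB,
    smul_smul, smul_smul, mul_comm, sub_self]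

variable {Γ : Type*} [Group Γ] {a b : Γ}

/-- The value of the Fricke polynomial at the traces of `a`, `b` and `a * b`. -/
def characterKappa (a b : Γ) (χ : Γ → F) : F := frickeKappa (χ a) (χ b) (χ (a * b))

theorem det_commutator_eq_neg_characterKappa (a b : Γ) {χ : Γ → F} {ρ : Γ →* SL(2, F)}
    (h : IsSL2CharacterOf χ ρ) :
    ((ρ a : Matrix (Fin 2) (Fin 2) F) * ρ b - (ρ b : Matrix (Fin 2) (Fin 2) F) * ρ a).det
      = -characterKappa a b χ := by
  rw [Matrix.det_commutator_eq_neg_frickeKappa (ρ a).2 (ρ b).2, characterKappa, h, h, h,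
    SL2Rep.coe_map_mul]

theorem SL2Rep.exists_eigenvalue_of_closure (hab : Subgroup.closure {a, b} = ⊤)
    (ρ : Γ →* SL(2, F)) {v : Fin 2 → F} (hv : v ≠ 0)
    (ha : ∃ c : F, (ρ a : Matrix (Fin 2) (Fin 2) F) *ᵥ v = c • v)
    (hb : ∃ c : F, (ρ b : Matrix (Fin 2) (Fin 2) F) *ᵥ v = c • v) (γ : Γ) :
    ∃ c : F, (ρ γ : Matrix (Fin 2) (Fin 2) F) *ᵥ v = c • v := by
  have hγ : γ ∈ Subgroup.closure {a, b} := hab ▸ Subgroup.mem_top γ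
  induction hγ using Subgroup.closure_induction with
  | mem x hx =>
    rcases hx with rfl | rfl
    exacts [ha, hb]
  | one => exact ⟨1, by simp⟩
  | mul x y _ _ hx hy =>
    obtain ⟨c, hc⟩ := hx
    obtain ⟨d, hd⟩ := hy
    exact ⟨d * c, by rw [SL2Rep.coe_map_mul, ← mulVec_mulVec, hd, mulVec_smul, hc, smul_smul]⟩
  | inv x _ hx =>
    obtain ⟨c, hc⟩ := hx
    have h1 : (ρ x⁻¹ : Matrix (Fin 2) (Fin 2) F) *ᵥ (ρ x : Matrix (Fin 2) (Fin 2) F) *ᵥ v = v := by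
      rw [mulVec_mulVec, ← SL2Rep.coe_map_mul]
      simp
    rw [hc, mulVec_smul] at h1
    have hc0 : c ≠ 0 := by
      rintro rfl
      exact hv (by rw [← h1, zero_smul])
    exact ⟨c⁻¹, by rw [eq_inv_smul_iff₀ hc0, h1]⟩

/-- A proper nonzero subrepresentation of a plane is a line, hence gives a common eigenvector of `ρ
a` and `ρ b`. -/
theorem SL2Rep.isIrreducible_of_characterKappa_ne_zero {χ : Γ → F}
    {ρ : Γ →* SL(2, F)} (h : IsSL2CharacterOf χ ρ) (hκ : characterKappa a b χ ≠ 0) :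
    (SL2Rep.toRepresentation ρ).IsIrreducible := by
  have hbot : ∀ W : Subrepresentation (SL2Rep.toRepresentation ρ),
      W.toSubmodule = ⊥ → W = ⊥ := fun W hW => Subrepresentation.toSubmodule_injective hW
  have htop : ∀ W : Subrepresentation (SL2Rep.toRepresentation ρ),
      W.toSubmodule = ⊤ → W = ⊤ := fun W hW => Subrepresentation.toSubmodule_injective hW
  have : Nontrivial (Subrepresentation (SL2Rep.toRepresentation ρ)) :=
    ⟨⊥, ⊤, fun hc => bot_ne_top (α := Submodule F (Fin 2 → F))
      (congrArg Subrepresentation.toSubmodule hc)⟩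
  refine ⟨fun W => ?_⟩
  by_contra! hW
  have hlt := Submodule.finrank_lt (lt_top_iff_ne_top.mpr fun hc => hW.2 (htop W hc)).ne
  rw [Module.finrank_fin_fun, Nat.lt_succ_iff, finrank_le_one_iff] at hlt
  obtain ⟨v, hv⟩ := hlt
  have hv0 : (v : Fin 2 → F) ≠ 0 := by
    intro hc
    refine hW.1 (hbot W ((Submodule.eq_bot_iff _).mpr fun x hx => ?_))
    obtain ⟨c, hc'⟩ := hv ⟨x, hx⟩
    have := congrArg Subtype.val hc'
    simpa [hc] using this.symm
  have hstable : ∀ γ, ∃ c : F, (ρ γ : Matrix (Fin 2) (Fin 2) F) *ᵥ (v : Fin 2 → F) = c • v := by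
    intro γ
    obtain ⟨c, hc⟩ := hv ⟨_, W.apply_mem_toSubmodule γ v.2⟩
    exact ⟨c, (congrArg Subtype.val hc).symm⟩
  obtain ⟨c, hc⟩ := hstable a
  obtain ⟨d, hd⟩ := hstable b
  have := Matrix.det_commutator_eq_zero_of_common_eigenvector hv0 hc hd
  rw [det_commutator_eq_neg_characterKappa a b h, neg_eq_zero] at this
  exact hκ this

theorem SL2Rep.characterKappa_ne_zero_of_isIrreducible [IsAlgClosed F]
    (hab : Subgroup.closure {a, b} = ⊤) {χ : Γ → F} {ρ : Γ →* SL(2, F)}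
    (h : IsSL2CharacterOf χ ρ) (hρ : (SL2Rep.toRepresentation ρ).IsIrreducible) :
    characterKappa a b χ ≠ 0 := by
  intro hκ
  have hdet := det_commutator_eq_neg_characterKappa a b h
  rw [hκ, neg_zero] at hdet
  obtain ⟨v, hv, ha, hb⟩ := Matrix.exists_common_eigenvector_of_det_commutator_eq_zero hdet
  let W : Subrepresentation (SL2Rep.toRepresentation ρ) :=
    { toSubmodule := Submodule.span F {v}
      apply_mem_toSubmodule := by
        intro γ w hw
        obtain ⟨e, rfl⟩ := Submodule.mem_span_singleton.mp hw
        obtain ⟨c, hc⟩ := SL2Rep.exists_eigenvalue_of_closure hab ρ hv ha hb γ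
        rw [map_smul]
        refine Submodule.smul_mem _ _ ?_
        change (Matrix.toLin' (ρ γ : Matrix (Fin 2) (Fin 2) F)) v ∈ _
        rw [Matrix.toLin'_apply, hc]
        exact Submodule.smul_mem _ _ (Submodule.mem_span_singleton_self v) }
  rcases hρ.eq_bot_or_eq_top W with hW | hW
  · have : Submodule.span F {v} = ⊥ := congrArg Subrepresentation.toSubmodule hW
    exact hv (Submodule.span_singleton_eq_bot.mp this)
  · have : Submodule.span F {v} = ⊤ := congrArg Subrepresentation.toSubmodule hW
    have h1 := finrank_span_singleton (K := F) hv
    rw [this, finrank_top, Module.finrank_fin_fun] at h1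
    norm_num at h1

end Irreducible

theorem IsAlgClosed.exists_add_inv_eq {F : Type*} [Field F] [IsAlgClosed F] (z : F) :
    ∃ u : F, u ≠ 0 ∧ u + u⁻¹ = z := by
  have hd : (Polynomial.X ^ 2 - Polynomial.C z * Polynomial.X + 1 : Polynomial F).degree ≠ 0 := by
    have : (Polynomial.X ^ 2 - Polynomial.C z * Polynomial.X + 1 : Polynomial F).degree = 2 := by
      compute_degree!
    rw [this]
    norm_num
  obtain ⟨u, hu⟩ := IsAlgClosed.exists_root _ hd
  have hu : u ^ 2 - z * u + 1 = 0 := by simpa [Polynomial.IsRoot] using hu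
  have hu0 : u ≠ 0 := by
    rintro rfl
    simp at hu
  refine ⟨u, hu0, ?_⟩
  field_simp
  linear_combination hu

/-! ### Basic properties of the polynomials `S`. -/

section ChebyshevS

open Polynomial Polynomial.Chebyshev

theorem Polynomial.Chebyshev.monic_and_natDegree_S (R : Type*) [CommRing R] [Nontrivial R]
    (k : ℕ) : (S R k).Monic ∧ (S R k).natDegree = k := by
  induction k using Nat.twoStepInduction with
  | zero => simp
  | one => simp
  | more k h0 h1 =>
    push_cast at *
    have hM : (X * S R (k + 1)).Monic := monic_X.mul h1.1
    have hD : (X * S R (k + 1)).natDegree = k + 2 := by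
      rw [monic_X.natDegree_mul h1.1, natDegree_X, h1.2]; ring
    have hlt : (S R k).natDegree < (X * S R (k + 1)).natDegree := by rw [h0.2, hD]; omega
    rw [S_add_two]
    exact ⟨hM.sub_of_left (degree_lt_degree hlt), by
      rw [natDegree_sub_eq_left_of_natDegree_lt hlt, hD]⟩

theorem Polynomial.Chebyshev.monic_S_sub_one (R : Type*) [CommRing R] [Nontrivial R] {k : ℕ}
    (hk : k ≠ 0) : (S R ((k : ℤ) - 1)).Monic := by
  obtain ⟨k, rfl⟩ := Nat.exists_eq_succ_of_ne_zero hk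
  simpa using (monic_and_natDegree_S R k).1

/-- At a root of `S (k - 1)` the `k`-th power of a matrix in `SL₂` is the scalar `-S (k - 2)`; this
scalar has determinant one. -/
theorem Polynomial.Chebyshev.eval_S_sub_two_sq {R : Type*} [CommRing R] {k : ℤ} {s : R}
    (hs : (S R (k - 1)).eval s = 0) : (S R (k - 2)).eval s ^ 2 = 1 := by
  have h := congrArg (Polynomial.eval s) (S_sq_add_S_sq R (k - 2))
  rw [show k - 2 + 1 = k - 1 by ring] at h
  simpa [hs] using h

theorem Polynomial.Chebyshev.eval_S_map {R R' : Type*} [CommRing R] [CommRing R'] (f : R →+* R')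
    (i : ℤ) (x : R) : (S R' i).eval (f x) = f ((S R i).eval x) := by
  rw [← map_S f, eval_map, eval₂_hom]

end ChebyshevS

/-! ### Components of the character variety as lines. -/

namespace TorusKnotGroup

open Polynomial.Chebyshev CharacterVariety

variable {m n : ℕ} {F : Type*} [Field F]

/-- The generator `a` of the torus knot group. -/
abbrev a (m n : ℕ) : TorusKnotGroup m n := PresentedGroup.of true

/-- The generator `b` of the torus knot group. -/
abbrev b (m n : ℕ) : TorusKnotGroup m n := PresentedGroup.of false

theorem closure_generators (m n : ℕ) : Subgroup.closure {a m n, b m n} = ⊤ := by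
  rw [← PresentedGroup.closure_range_of]
  congr 1
  ext x
  simp [or_comm]

theorem a_pow_eq_b_pow (m n : ℕ) : a m n ^ m = b m n ^ n := by
  have h := PresentedGroup.one_of_mem
    (rels := ({FreeGroup.of true ^ m * (FreeGroup.of false ^ n)⁻¹} : Set (FreeGroup Bool)))
    (Set.mem_singleton _)
  rw [map_mul, map_inv, map_pow, map_pow, mul_inv_eq_one] at h
  exact h

theorem exists_hom {G : Type*} [Group G] (x y : G) (h : x ^ m = y ^ n) :
    ∃ f : TorusKnotGroup m n →* G, f (a m n) = x ∧ f (b m n) = y := by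
  refine ⟨PresentedGroup.toGroup (f := fun i => cond i x y) ?_, ?_, ?_⟩
  · rintro r rfl
    simp [h]
  · simp
  · simp

/-- The pairs `(tr ρ(a), tr ρ(b))` of the irreducible representations `ρ` of the torus knot group
in `SL₂(F)`. -/
def tracePairs (m n : ℕ) (F : Type*) [Field F] : Set (F × F) :=
  {q | (S F ((m : ℤ) - 1)).eval q.1 = 0 ∧ (S F ((n : ℤ) - 1)).eval q.2 = 0 ∧
    (S F ((m : ℤ) - 2)).eval q.1 = (S F ((n : ℤ) - 2)).eval q.2}

/-- The characters with given values at the two generators. -/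
def traceLine (m n : ℕ) (q : F × F) : Set (CharacterVariety (TorusKnotGroup m n) F) :=
  {χ | χ.val (a m n) = q.1 ∧ χ.val (b m n) = q.2}

theorem finite_tracePairs (hm : m ≠ 0) (hn : n ≠ 0) : (tracePairs m n F).Finite := by
  have h : ∀ {k : ℕ}, k ≠ 0 → {s | (S F ((k : ℤ) - 1)).IsRoot s}.Finite := fun hk =>
    Polynomial.finite_setOfPred_isRoot (monic_S_sub_one F hk).ne_zero
  exact ((h hm).prod (h hn)).subset fun q hq => ⟨hq.1, hq.2.1⟩

theorem mem_tracePairs_of_characterKappa_ne_zero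
    {χ : CharacterVariety (TorusKnotGroup m n) F}
    (h : characterKappa (a m n) (b m n) χ.val ≠ 0) :
    (χ.val (a m n), χ.val (b m n)) ∈ tracePairs m n F := by
  obtain ⟨ρ, hρ⟩ := χ.isCharacter
  set A : Matrix (Fin 2) (Fin 2) F := (ρ (a m n)).1 with hA
  set B : Matrix (Fin 2) (Fin 2) F := (ρ (b m n)).1 with hB
  have hdet := det_commutator_eq_neg_characterKappa (a m n) (b m n) hρ
  have hAB : A * B - B * A ≠ 0 := by
    intro hc
    rw [← hA, ← hB, hc, Matrix.det_zero, eq_comm, neg_eq_zero] at hdet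
    exact h hdet
  have hpow : A ^ m = B ^ n := by
    have := congrArg (fun γ => (ρ γ : SL(2, F)).1) (a_pow_eq_b_pow m n)
    simp only [map_pow] at this
    exact this
  have hAm := Matrix.pow_eq_chebyshev (A := A) (ρ (a m n)).2 m
  have hBn := Matrix.pow_eq_chebyshev (A := B) (ρ (b m n)).2 n
  rw [hA, ← hρ, ← hA] at hAm
  rw [hB, ← hρ, ← hB] at hBn
  have h1 : (S F ((m : ℤ) - 1)).eval (χ.val (a m n)) = 0 := by
    -- Expanding `A ^ m`, its commutator with `B` is a Chebyshev value times the nonzero commutator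
    -- of `A` and `B`.
    have hc : A ^ m * B - B * A ^ m = 0 := by rw [hpow, ← pow_succ, ← pow_succ', sub_self]
    rw [hAm] at hc
    have : (S F ((m : ℤ) - 1)).eval (χ.val (a m n)) • (A * B - B * A) = 0 := by
      rw [← hc]
      simp only [sub_mul, mul_sub, smul_mul_assoc, mul_smul_comm, one_mul, mul_one, smul_sub]
      abel
    exact (smul_eq_zero.mp this).resolve_right hAB
  have h2 : (S F ((n : ℤ) - 1)).eval (χ.val (b m n)) = 0 := by
    have hc : A * B ^ n - B ^ n * A = 0 := by rw [← hpow, ← pow_succ, ← pow_succ', sub_self]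
    rw [hBn] at hc
    have : (S F ((n : ℤ) - 1)).eval (χ.val (b m n)) • (A * B - B * A) = 0 := by
      rw [← hc]
      simp only [sub_mul, mul_sub, smul_mul_assoc, mul_smul_comm, one_mul, mul_one, smul_sub]
      abel
    exact (smul_eq_zero.mp this).resolve_right hAB
  refine ⟨h1, h2, ?_⟩
  rw [hAm, hBn, h1, h2] at hpow
  simpa using congrFun (congrFun hpow 0) 0

theorem exists_mem_traceLine [IsAlgClosed F] {q : F × F} (hq : q ∈ tracePairs m n F) (z : F) :
    ∃ χ ∈ traceLine m n q, χ.val (a m n * b m n) = z := by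
  obtain ⟨u, hu0, hu⟩ := IsAlgClosed.exists_add_inv_eq z
  -- The diagonal of `A * B` is `u⁻¹`, `u`, so `u` tunes the third trace to `z` without changing the
  -- other two.
  let A : SL(2, F) := ⟨!![q.1, -1; 1, 0], by simp [det_fin_two]⟩
  let B : SL(2, F) := ⟨!![0, u; -u⁻¹, q.2], by simp [det_fin_two, hu0]⟩
  have htA : A.1.trace = q.1 := by simp [A, trace_fin_two]
  have htB : B.1.trace = q.2 := by simp [B, trace_fin_two]
  have htAB : (A.1 * B.1).trace = z := by
    simp only [A, B, trace_fin_two, Matrix.mul_apply, Fin.sum_univ_two]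
    simpa [add_comm] using hu
  have hpow : A ^ m = B ^ n := by
    apply Subtype.ext
    change A.1 ^ m = B.1 ^ n
    rw [Matrix.pow_eq_chebyshev A.2, Matrix.pow_eq_chebyshev B.2, htA, htB, hq.1, hq.2.1, hq.2.2,
      zero_smul, zero_smul]
  obtain ⟨ρ, hρa, hρb⟩ := exists_hom A B hpow
  refine ⟨⟨fun γ => trace (ρ γ : Matrix (Fin 2) (Fin 2) F), ρ, fun _ => rfl⟩, ⟨?_, ?_⟩, ?_⟩
  · simp only [hρa, htA]
  · simp only [hρb, htB]
  · simp only [SL2Rep.coe_map_mul, hρa, hρb, htAB]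

theorem isClosed_iff_exists_zeroSet {Γ : Type*} [Group Γ] {Z : Set (CharacterVariety Γ F)} :
    IsClosed Z ↔ ∃ T : Set (MvPolynomial Γ F), Z = zeroSet T := by
  rw [← isOpen_compl_iff]
  change Zᶜᶜ ∈ _ ↔ _
  rw [compl_compl]
  rfl

theorem isClosed_traceLine (q : F × F) : IsClosed (traceLine m n q) := by
  refine isClosed_iff_exists_zeroSet.mpr ⟨{MvPolynomial.X (a m n) - MvPolynomial.C q.1,
    MvPolynomial.X (b m n) - MvPolynomial.C q.2}, ?_⟩
  ext χ
  simp [traceLine, zeroSet, sub_eq_zero]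

open MvPolynomial in
theorem isClosed_setOf_characterKappa_eq_zero {Γ : Type*} [Group Γ] (a b : Γ) :
    IsClosed {χ : CharacterVariety Γ F | characterKappa a b χ.val = 0} := by
  refine isClosed_iff_exists_zeroSet.mpr
    ⟨{X a ^ 2 + X b ^ 2 + X (a * b) ^ 2 - X a * X b * X (a * b) - C 4}, ?_⟩
  ext χ
  simp only [zeroSet, Set.mem_ofPred_eq, Set.mem_singleton_iff, forall_eq, map_sub, map_add,
    map_mul, map_pow, eval_X, eval_C, characterKappa, frickeKappa]

/-- The restriction of a polynomial in the trace coordinates to the line on which the two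
generators have traces `s` and `t`, as a polynomial in the trace of their product; here `P γ`
expresses the trace of `γ` through these three traces. -/
noncomputable def restrictToLine {Γ R : Type*} [CommRing R] (P : Γ → MvPolynomial (Fin 3) ℤ)
    (s t : R) (f : MvPolynomial Γ R) : Polynomial R :=
  MvPolynomial.aeval
    (fun γ => MvPolynomial.aeval ![Polynomial.C s, Polynomial.C t, Polynomial.X] (P γ)) f

/-- The ring map `j` is left free so as to cover the identity of `F`, the inclusion of the algebraic
integers in `ℂ`, and the reduction `φ`. -/
theorem eval₂_eq_eval₂_restrictToLine {Γ R : Type*} [CommRing R]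
    {P : Γ → MvPolynomial (Fin 3) ℤ} {χ : Γ → F} {z : F} (j : R →+* F) {s t : R}
    (hP : ∀ γ, χ γ = MvPolynomial.aeval ![j s, j t, z] (P γ)) (f : MvPolynomial Γ R) :
    MvPolynomial.eval₂ j χ f = Polynomial.eval₂ j z (restrictToLine P s t f) := by
  unfold restrictToLine
  induction f using MvPolynomial.induction_on with
  | C r => simp
  | add f g hf hg => rw [MvPolynomial.eval₂_add, hf, hg, map_add, Polynomial.eval₂_add]
  | mul_X f γ hf =>
    rw [MvPolynomial.eval₂_mul, hf, map_mul, Polynomial.eval₂_mul, MvPolynomial.eval₂_X,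
      MvPolynomial.aeval_X, hP]
    congr 1
    have h := MvPolynomial.comp_aeval_apply ![Polynomial.C s, Polynomial.C t, Polynomial.X]
      (Polynomial.eval₂RingHom j z).toIntAlgHom (P γ)
    refine Eq.trans ?_ h.symm
    congr 2
    ext i
    fin_cases i <;> simp

/-- One family `P` serves both fields, which is what lets identities pass from `ℂ` to `F`. -/
theorem exists_tracePolynomials (m n : ℕ) (K L : Type*) [Field K] [Field L] :
    ∃ P : TorusKnotGroup m n → MvPolynomial (Fin 3) ℤ,
      (∀ (χ : CharacterVariety (TorusKnotGroup m n) K) (γ : TorusKnotGroup m n), χ.val γ =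
        MvPolynomial.aeval ![χ.val (a m n), χ.val (b m n), χ.val (a m n * b m n)] (P γ)) ∧
      ∀ (χ : CharacterVariety (TorusKnotGroup m n) L) (γ : TorusKnotGroup m n), χ.val γ =
        MvPolynomial.aeval ![χ.val (a m n), χ.val (b m n), χ.val (a m n * b m n)] (P γ) := by
  choose P hK hL using exists_tracePolynomial (K := K) (L := L) (closure_generators m n)
  refine ⟨P, fun χ γ => ?_, fun χ γ => ?_⟩
  · obtain ⟨ρ, hρ⟩ := χ.isCharacter
    simp only [hρ _, hK γ ρ, traceTriple]
  · obtain ⟨ρ, hρ⟩ := χ.isCharacter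
    simp only [hρ _, hL γ ρ, traceTriple]

/-- Functions on the line are one-variable polynomials in the trace of `a * b`, which takes every
value; these polynomials have no zero divisors. -/
theorem isPreirreducible_traceLine [IsAlgClosed F] {q : F × F} (hq : q ∈ tracePairs m n F) :
    IsPreirreducible (traceLine m n q) := by
  obtain ⟨P, hP, -⟩ := exists_tracePolynomials m n F F
  have heval : ∀ χ ∈ traceLine m n q, ∀ f, MvPolynomial.eval χ.val f
      = (restrictToLine P q.1 q.2 f).eval (χ.val (a m n * b m n)) := fun χ hχ f =>
    eval₂_eq_eval₂_restrictToLine (RingHom.id F)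
      (fun γ => by have := hP χ γ; rwa [hχ.1, hχ.2] at this) f
  refine isPreirreducible_iff_isClosed_union_isClosed.mpr fun Z₁ Z₂ h₁ h₂ h => ?_
  obtain ⟨T₁, rfl⟩ := isClosed_iff_exists_zeroSet.mp h₁
  obtain ⟨T₂, rfl⟩ := isClosed_iff_exists_zeroSet.mp h₂
  by_contra! hc
  obtain ⟨⟨χ₁, hχ₁, hc₁⟩, χ₂, hχ₂, hc₂⟩ := And.imp Set.not_subset.mp Set.not_subset.mp hc
  simp only [zeroSet, Set.mem_ofPred_eq, not_forall] at hc₁ hc₂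
  obtain ⟨f, hf, hf0⟩ := hc₁
  obtain ⟨g, hg, hg0⟩ := hc₂
  have hfg : restrictToLine P q.1 q.2 f * restrictToLine P q.1 q.2 g = 0 := by
    refine Polynomial.funext fun z => ?_
    obtain ⟨χ, hχ, rfl⟩ := exists_mem_traceLine hq z
    rw [Polynomial.eval_mul, ← heval χ hχ, ← heval χ hχ, Polynomial.eval_zero, mul_eq_zero]
    exact (h hχ).imp (fun h => h f hf) fun h => h g hg
  rcases mul_eq_zero.mp hfg with h0 | h0
  · exact hf0 (by rw [heval χ₁ hχ₁, h0, Polynomial.eval_zero])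
  · exact hg0 (by rw [heval χ₂ hχ₂, h0, Polynomial.eval_zero])

theorem isIrreducibleCharacter_iff [IsAlgClosed F] (χ : CharacterVariety (TorusKnotGroup m n) F) :
    χ.IsIrreducibleCharacter ↔ characterKappa (a m n) (b m n) χ.val ≠ 0 := by
  constructor
  · rintro ⟨ρ, hρ, hirr⟩
    exact SL2Rep.characterKappa_ne_zero_of_isIrreducible (closure_generators m n) hρ hirr
  · intro h
    obtain ⟨ρ, hρ⟩ := χ.isCharacter
    exact ⟨ρ, hρ, SL2Rep.isIrreducible_of_characterKappa_ne_zero hρ h⟩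

theorem exists_isIrreducibleCharacter_mem_traceLine [IsAlgClosed F] {q : F × F}
    (hq : q ∈ tracePairs m n F) : ∃ χ ∈ traceLine m n q, χ.IsIrreducibleCharacter := by
  by_contra! hc
  simp only [isIrreducibleCharacter_iff, not_not] at hc
  have h0 : (Polynomial.X ^ 2 - Polynomial.C (q.1 * q.2) * Polynomial.X
      + Polynomial.C (q.1 ^ 2 + q.2 ^ 2 - 4) : Polynomial F) = 0 := by
    refine Polynomial.funext fun z => ?_
    obtain ⟨χ, hχ, rfl⟩ := exists_mem_traceLine hq z
    have := hc χ hχ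
    rw [characterKappa, frickeKappa, hχ.1, hχ.2] at this
    simp only [Polynomial.eval_add, Polynomial.eval_sub, Polynomial.eval_mul, Polynomial.eval_pow,
      Polynomial.eval_X, Polynomial.eval_C, Polynomial.eval_zero]
    linear_combination this
  have h1 := congrArg (fun f => Polynomial.coeff f 2) h0
  -- On the line, the Fricke polynomial is a monic quadratic in the third trace, so it cannot vanish
  -- identically.
  simp only [Polynomial.coeff_add, Polynomial.coeff_sub, Polynomial.coeff_X_pow,
    Polynomial.coeff_C_mul, Polynomial.coeff_X, Polynomial.coeff_C, Polynomial.coeff_zero] at h1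
  norm_num at h1

theorem eq_of_subset_traceLine [IsAlgClosed F] {q q' : F × F} (hq : q ∈ tracePairs m n F)
    (h : traceLine m n q ⊆ traceLine m n q') : q = q' := by
  obtain ⟨χ, hχ, -⟩ := exists_mem_traceLine hq 0
  exact Prod.ext (hχ.1.symm.trans (h hχ).1) (hχ.2.symm.trans (h hχ).2)

theorem exists_subset_traceLine [IsAlgClosed F] (hm : m ≠ 0) (hn : n ≠ 0)
    {Z : Set (CharacterVariety (TorusKnotGroup m n) F)} (hZ : IsIrreducible Z)
    {χ : CharacterVariety (TorusKnotGroup m n) F} (hχ : χ ∈ Z) (hirr : χ.IsIrreducibleCharacter) :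
    ∃ q ∈ tracePairs m n F, Z ⊆ traceLine m n q := by
  classical
  set R : Set (CharacterVariety (TorusKnotGroup m n) F) :=
    {χ | characterKappa (a m n) (b m n) χ.val = 0} with hR
  have hfin := finite_tracePairs (F := F) hm hn
  obtain ⟨C, hC, hZC⟩ := isIrreducible_iff_sUnion_isClosed.mp hZ
    (insert R (hfin.toFinset.image (traceLine m n))) (by
      intro C hC
      simp only [Finset.mem_insert, Finset.mem_image] at hC
      rcases hC with rfl | ⟨q, -, rfl⟩
      · exact isClosed_setOf_characterKappa_eq_zero _ _
      · exact isClosed_traceLine q) (by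
      intro ψ _
      by_cases hψ : characterKappa (a m n) (b m n) ψ.val = 0
      · exact ⟨R, by simp, hψ⟩
      · exact ⟨traceLine m n (ψ.val (a m n), ψ.val (b m n)), Finset.mem_insert_of_mem
          (Finset.mem_image_of_mem _
            (hfin.mem_toFinset.mpr (mem_tracePairs_of_characterKappa_ne_zero hψ))), rfl, rfl⟩)
  simp only [Finset.mem_insert, Finset.mem_image, Set.Finite.mem_toFinset] at hC
  rcases hC with rfl | ⟨q, hq, rfl⟩
  · exact absurd (hZC hχ) ((isIrreducibleCharacter_iff χ).mp hirr)
  · exact ⟨q, hq, hZC⟩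

/-- The components of the character variety of a torus knot group that contain irreducible
characters are the lines on which the two generators have prescribed traces. -/
theorem irrCharComponents_eq_image_traceLine [IsAlgClosed F] (hm : m ≠ 0) (hn : n ≠ 0) :
    irrCharComponents (TorusKnotGroup m n) F = traceLine m n '' tracePairs m n F := by
  have hirred : ∀ q ∈ tracePairs m n F, IsIrreducible (traceLine m n q) := fun q hq =>
    ⟨(exists_mem_traceLine hq 0).imp fun _ h => h.1, isPreirreducible_traceLine hq⟩
  ext Z
  constructor
  · rintro ⟨hZ, χ, hχ, hirr⟩
    obtain ⟨q, hq, hsub⟩ := exists_subset_traceLine hm hn hZ.1 hχ hirr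
    exact ⟨q, hq, (hZ.eq_of_le (hirred q hq) hsub).symm⟩
  · rintro ⟨q, hq, rfl⟩
    obtain ⟨χ, hχ, hirr⟩ := exists_isIrreducibleCharacter_mem_traceLine hq
    refine ⟨⟨hirred q hq, fun Z hZ hsub => ?_⟩, χ, hχ, hirr⟩
    obtain ⟨q', -, hsub'⟩ := exists_subset_traceLine hm hn hZ (hsub hχ) hirr
    rwa [eq_of_subset_traceLine hq (hsub.trans hsub')]

theorem encard_irrCharComponents [IsAlgClosed F] (hm : m ≠ 0) (hn : n ≠ 0) :
    (irrCharComponents (TorusKnotGroup m n) F).encard = (tracePairs m n F).encard := by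
  rw [irrCharComponents_eq_image_traceLine hm hn]
  exact Set.InjOn.encard_image fun q hq q' _ h => eq_of_subset_traceLine hq h.subset

theorem reduction_traceLine [IsAlgClosed F] (φ : integralClosure ℤ ℂ →+* F)
    {s t : integralClosure ℤ ℂ} (hst : ((s : ℂ), (t : ℂ)) ∈ tracePairs m n ℂ) :
    reduction φ (traceLine m n ((s : ℂ), (t : ℂ))) = traceLine m n (φ s, φ t) := by
  obtain ⟨P, hPC, hPF⟩ := exists_tracePolynomials m n ℂ F
  ext χ
  constructor
  · intro h
    have h1 := h _ ⟨MvPolynomial.X (a m n) - MvPolynomial.C s, fun ψ hψ => by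
      simpa [sub_eq_zero] using hψ.1, rfl⟩
    have h2 := h _ ⟨MvPolynomial.X (b m n) - MvPolynomial.C t, fun ψ hψ => by
      simpa [sub_eq_zero] using hψ.2, rfl⟩
    simp only [map_sub, MvPolynomial.map_X, MvPolynomial.map_C, MvPolynomial.eval_X,
      MvPolynomial.eval_C, sub_eq_zero] at h1 h2
    exact ⟨h1, h2⟩
  · rintro hχ g ⟨f, hf, rfl⟩
    -- The restriction already has algebraic integer coefficients; it vanishes at every complex
    -- number, hence is zero before reduction.
    have hf0 : restrictToLine P s t f = 0 := by
      apply Polynomial.map_injective (algebraMap (integralClosure ℤ ℂ) ℂ)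
        (FaithfulSMul.algebraMap_injective _ _)
      refine Polynomial.funext fun z => ?_
      obtain ⟨ψ, hψ, rfl⟩ := exists_mem_traceLine hst z
      rw [Polynomial.eval_map, Polynomial.map_zero, Polynomial.eval_zero,
        ← eval₂_eq_eval₂_restrictToLine (χ := ψ.val) _ (fun γ => ?_) f]
      · exact hf ψ hψ
      · have := hPC ψ γ
        rwa [hψ.1, hψ.2] at this
    rw [MvPolynomial.eval_map, eval₂_eq_eval₂_restrictToLine (P := P)
      (z := χ.val (a m n * b m n)) φ (fun γ => ?_) f, hf0, Polynomial.eval₂_zero]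
    have := hPF χ γ
    rwa [hχ.1, hχ.2] at this

end TorusKnotGroup

/-! ### Roots of `S`: simplicity, characteristic `p`, parity and lifting. -/

section ChebyshevSRoots

open Polynomial Polynomial.Chebyshev

theorem Polynomial.Chebyshev.X_sq_sub_four_mul_derivative_S (R : Type*) [CommRing R] (k : ℕ) :
    (X ^ 2 - 4) * derivative (S R k)
      = 2 * ((k : R[X]) + 1) * S R (k + 1) - ((k : R[X]) + 2) * X * S R k := by
  induction k using Nat.twoStepInduction with
  | zero => simp
  | one =>
    have h2 : S R (1 + 1) = X ^ 2 - 1 := S_two R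
    simp only [Nat.cast_one, S_one, derivative_X, h2]
    ring
  | more k h0 h1 =>
    have e1 : S R ((k : ℤ) + 2) = X * S R (k + 1) - S R k := S_add_two R k
    have e2 : S R ((k : ℤ) + 2 + 1) = X * S R (k + 2) - S R (k + 1) := by
      have := S_add_two R ((k : ℤ) + 1)
      rwa [show (k : ℤ) + 1 + 2 = k + 2 + 1 by ring, show (k : ℤ) + 1 + 1 = k + 2 by ring] at this
    push_cast at h0 h1 ⊢
    rw [show (k : ℤ) + 1 + 1 = k + 2 by ring] at h1
    have hd : derivative (S R ((k : ℤ) + 2))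
        = S R (k + 1) + X * derivative (S R (k + 1)) - derivative (S R k) := by
      rw [e1]
      simp
    rw [hd, e2]
    rw [e1] at h1 ⊢
    linear_combination X * h1 - h0

/-- At a double root the differential equation would force `S (k + 1)` to vanish too, but its square
there is one. -/
theorem Polynomial.Chebyshev.eval_derivative_S_ne_zero {F : Type*} [Field F] (h2 : (2 : F) ≠ 0)
    {k : ℕ} (hk : ((k + 1 : ℕ) : F) ≠ 0) {s : F} (hs : (S F k).eval s = 0) :
    (derivative (S F k)).eval s ≠ 0 := by
  intro h0
  have h := congrArg (eval s) (X_sq_sub_four_mul_derivative_S F k)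
  have hsq := congrArg (eval s) (S_sq_add_S_sq F k)
  simp [hs, h0] at h hsq
  push_cast at hk
  rcases h with (h | h) | h
  · exact h2 h
  · exact hk h
  · simp [h] at hsq

/-- If `k` and `2` are invertible then the Chebyshev polynomial `S (k - 1)` has `k - 1` roots. -/
theorem Polynomial.Chebyshev.ncard_roots_S {F : Type*} [Field F] [IsAlgClosed F]
    (h2 : (2 : F) ≠ 0) {k : ℕ} (hk : (k : F) ≠ 0) :
    {s | (S F ((k : ℤ) - 1)).eval s = 0}.ncard = k - 1 := by
  classical
  obtain ⟨k, rfl⟩ := Nat.exists_eq_succ_of_ne_zero (n := k) (by rintro rfl; simp at hk)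
  have e : ((k.succ : ℕ) : ℤ) - 1 = k := by simp
  rw [e]
  obtain ⟨hM, hD⟩ := monic_and_natDegree_S F k
  have hnodup : (S F k).roots.Nodup := by
    rw [Multiset.nodup_iff_count_le_one]
    intro s
    rw [count_roots]
    by_contra! hlt
    obtain ⟨hr, hd⟩ := (one_lt_rootMultiplicity_iff_isRoot hM.ne_zero).mp hlt
    exact eval_derivative_S_ne_zero h2 hk hr hd
  have hset : {s | (S F k).eval s = 0} = ((S F k).roots.toFinset : Set F) := by
    ext s
    simp [hM.ne_zero]
  rw [hset, Set.ncard_coe_finset, Multiset.toFinset_card_of_nodup hnodup,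
    splits_iff_card_roots.mp (IsAlgClosed.splits _), hD, Nat.succ_sub_one]

theorem Polynomial.Chebyshev.eval_S_add_inv {F : Type*} [Field F] {u : F} (hu : u ≠ 0) (k : ℕ) :
    (S F ((k : ℤ) - 1)).eval (u + u⁻¹) * (u - u⁻¹) = u ^ k - u⁻¹ ^ k := by
  induction k using Nat.twoStepInduction with
  | zero => simp
  | one => simp
  | more k h0 h1 =>
    have e : S F (((k + 2 : ℕ) : ℤ) - 1)
        = X * S F (((k + 1 : ℕ) : ℤ) - 1) - S F ((k : ℤ) - 1) := by
      have := S_add_two F ((k : ℤ) - 1)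
      push_cast
      rwa [show (k : ℤ) - 1 + 2 = k + 2 - 1 by ring,
        show (k : ℤ) - 1 + 1 = k + 1 - 1 by ring] at this
    have hinv : u * u⁻¹ = 1 := mul_inv_cancel₀ hu
    rw [e, eval_sub, eval_mul, eval_X, sub_mul, mul_assoc, h1, h0]
    linear_combination (u ^ k - u⁻¹ ^ k) * hinv

/-- In characteristic `p`, multiplying `k` by a power of `p` adds the roots `2` and `-2`. -/
theorem Polynomial.Chebyshev.setOf_eval_S_char_pow_mul_eq_zero {F : Type*} [Field F]
    [IsAlgClosed F] {p : ℕ} [Fact p.Prime] [CharP F p] {r : ℕ} (hr : r ≠ 0) (k : ℕ) :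
    {s | (S F (((p ^ r * k : ℕ) : ℤ) - 1)).eval s = 0}
      = insert 2 (insert (-2) {s | (S F ((k : ℤ) - 1)).eval s = 0}) := by
  have hp0 : (((p ^ r * k : ℕ) : ℤ) : F) = 0 := by
    push_cast
    rw [CharP.cast_eq_zero, zero_pow hr, zero_mul]
  ext s
  simp only [Set.mem_insert_iff, Set.mem_ofPred_eq]
  by_cases h2 : s = 2
  · simp only [h2, true_or, iff_true, S_eval_two]
    rw [Int.cast_sub, hp0]
    simp
  by_cases h2' : s = -2
  · simp only [h2', true_or, or_true, iff_true, S_eval_neg_two]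
    rw [Int.cast_sub, hp0]
    simp
  simp only [h2, h2', false_or]
  obtain ⟨u, hu0, hs⟩ := IsAlgClosed.exists_add_inv_eq s
  have hne : u - u⁻¹ ≠ 0 := by
    intro h
    have hsq : (s - 2) * (s + 2) = 0 := by
      rw [← hs]
      linear_combination (u - u⁻¹) * h + 4 * mul_inv_cancel₀ hu0
    rcases mul_eq_zero.mp hsq with h | h
    · exact h2 (sub_eq_zero.mp h)
    · exact h2' (eq_neg_of_add_eq_zero_left h)
  have key : ∀ j : ℕ, (S F ((j : ℤ) - 1)).eval s = 0 ↔ u ^ j - u⁻¹ ^ j = 0 := fun j => by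
    rw [← eval_S_add_inv hu0, hs, mul_eq_zero, or_iff_left hne]
  -- Frobenius turns the equation for `p ^ r * k` into the `p ^ r`-th power of the equation for `k`.
  rw [key, key, mul_comm (p ^ r), pow_mul, pow_mul, ← sub_pow_char_pow,
    pow_eq_zero_iff (pow_ne_zero r (Fact.out : p.Prime).ne_zero)]

theorem Polynomial.Chebyshev.ncard_roots_S_char_pow_mul {F : Type*} [Field F] [IsAlgClosed F]
    {p : ℕ} [Fact p.Prime] [CharP F p] (h2 : (2 : F) ≠ 0) {r : ℕ} (hr : r ≠ 0) {k : ℕ}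
    (hk : (k : F) ≠ 0) :
    {s | (S F (((p ^ r * k : ℕ) : ℤ) - 1)).eval s = 0}.ncard = k + 1 := by
  have hk0 : k ≠ 0 := by
    rintro rfl
    simp at hk
  have hfin : {s | (S F ((k : ℤ) - 1)).eval s = 0}.Finite :=
    Polynomial.finite_setOfPred_isRoot (monic_S_sub_one F hk0).ne_zero
  have h4 : (2 : F) ≠ -2 := by
    intro h
    have : (2 : F) * 2 = 0 := by linear_combination h
    simp [h2] at this
  rw [setOf_eval_S_char_pow_mul_eq_zero hr, Set.ncard_insert_of_notMem _ (hfin.insert _),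
    Set.ncard_insert_of_notMem _ hfin, ncard_roots_S h2 hk]
  · omega
  · simp [S_eval_neg_two, hk]
  · simp [S_eval_two, hk, h4]

/-- `S` of index `i` has the parity of `i`. For odd `m`, negation thus preserves the roots of `S (m
- 1)` and flips the sign of `S (m - 2)`. -/
theorem Polynomial.Chebyshev.eval_neg_S {R : Type*} [CommRing R] (s : R) (j : ℕ) :
    (S R (2 * j)).eval (-s) = (S R (2 * j)).eval s ∧
      (S R (2 * j - 1)).eval (-s) = -(S R (2 * j - 1)).eval s := by
  induction j with
  | zero => simp
  | succ j ih =>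
    have e1 : S R (2 * ((j + 1 : ℕ) : ℤ) - 1) = X * S R (2 * j) - S R (2 * j - 1) := by
      have := S_add_one R (2 * (j : ℤ))
      push_cast
      rwa [show 2 * (j : ℤ) + 1 = 2 * (j + 1) - 1 by ring] at this
    have e2 : S R (2 * ((j + 1 : ℕ) : ℤ)) = X * S R (2 * ((j + 1 : ℕ) : ℤ) - 1) - S R (2 * j) := by
      have := S_eq R (2 * ((j + 1 : ℕ) : ℤ))
      rwa [show 2 * ((j + 1 : ℕ) : ℤ) - 2 = 2 * j by push_cast; ring] at this
    have h1 : (S R (2 * ((j + 1 : ℕ) : ℤ) - 1)).eval (-s)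
        = -(S R (2 * ((j + 1 : ℕ) : ℤ) - 1)).eval s := by
      rw [e1]
      simp only [eval_sub, eval_mul, eval_X, ih.1, ih.2]
      ring
    refine ⟨?_, h1⟩
    rw [e2]
    simp only [eval_sub, eval_mul, eval_X, ih.1, h1]
    ring

/-- Every root of `S (k - 1)` in an algebraically closed field is the reduction of an algebraic
integer that is a root of `S (k - 1)`. -/
theorem Polynomial.Chebyshev.exists_integral_root_S {F : Type*} [Field F]
    (φ : integralClosure ℤ ℂ →+* F) {k : ℕ} (hk : k ≠ 0) {s : F}
    (hs : (S F ((k : ℤ) - 1)).eval s = 0) :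
    ∃ x : integralClosure ℤ ℂ, φ x = s ∧ (S (integralClosure ℤ ℂ) ((k : ℤ) - 1)).eval x = 0 := by
  set f := S (integralClosure ℤ ℂ) ((k : ℤ) - 1) with hf
  have hfM : f.Monic := monic_S_sub_one _ hk
  -- All complex roots of this monic integral polynomial are algebraic integers, so it splits before
  -- reduction, and its image under `φ` has only the reduced roots.
  have hsplit : f.Splits := by
    refine Splits.of_splits_map_of_injective
      (i := algebraMap (integralClosure ℤ ℂ) ℂ) (FaithfulSMul.algebraMap_injective _ _)
      (IsAlgClosed.splits _) fun x hx => ?_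
    have hx0 : (S ℤ ((k : ℤ) - 1)).eval₂ (algebraMap ℤ ℂ) x = 0 := by
      have := isRoot_of_mem_roots hx
      rwa [hf, map_S, ← map_S (algebraMap ℤ ℂ), IsRoot, eval_map] at this
    exact ⟨⟨x, _, monic_S_sub_one ℤ hk, hx0⟩, rfl⟩
  have hroot : (f.map φ).eval s = 0 := by rwa [hf, map_S]
  rw [eval_map, hsplit.eq_prod_roots_of_monic hfM, eval₂_multiset_prod, Multiset.map_map,
    Multiset.prod_eq_zero_iff, Multiset.mem_map] at hroot
  obtain ⟨x, hx, hx0⟩ := hroot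
  refine ⟨x, ?_, isRoot_of_mem_roots hx⟩
  simp only [Function.comp_apply, eval₂_sub, eval₂_X, eval₂_C] at hx0
  exact (sub_eq_zero.mp hx0).symm

end ChebyshevSRoots

/-! ### Counting and lifting trace pairs. -/

namespace TorusKnotGroup

open Polynomial.Chebyshev CharacterVariety

variable {m n : ℕ} {F : Type*} [Field F]

theorem ncard_tracePairs_comm (m n : ℕ) (F : Type*) [Field F] :
    (tracePairs m n F).ncard = (tracePairs n m F).ncard := by
  have h : tracePairs m n F = Prod.swap '' tracePairs n m F := by
    ext ⟨s, t⟩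
    simp only [Set.image_swap_eq_preimage_swap, Set.mem_preimage, Prod.swap_prod_mk, tracePairs,
      Set.mem_ofPred_eq]
    tauto
  rw [h, Set.ncard_image_of_injective _ Prod.swap_injective]

theorem two_mul_ncard_tracePairs_of_odd (h2 : (2 : F) ≠ 0) (hm : Odd m) (hn : n ≠ 0) :
    2 * (tracePairs m n F).ncard = {s | (S F ((m : ℤ) - 1)).eval s = 0}.ncard
      * {t | (S F ((n : ℤ) - 1)).eval t = 0}.ncard := by
  obtain ⟨j, rfl⟩ := hm
  have hj := fun s : F => eval_neg_S s j
  have e1 : ((2 * j + 1 : ℕ) : ℤ) - 1 = 2 * j := by push_cast; ring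
  have e2 : ((2 * j + 1 : ℕ) : ℤ) - 2 = 2 * j - 1 := by push_cast; ring
  have hfin := finite_tracePairs (F := F) (m := 2 * j + 1) (by omega) hn
  let σ : F × F → F × F := fun q => (-q.1, q.2)
  have hσ : Function.Involutive σ := fun q => by simp [σ]
  -- Both signs are `±1`; a pair of roots with opposite signs becomes a trace pair after negating
  -- the first root.
  have hunion : {s | (S F (((2 * j + 1 : ℕ) : ℤ) - 1)).eval s = 0}
      ×ˢ {t | (S F ((n : ℤ) - 1)).eval t = 0}
      = tracePairs (2 * j + 1) n F ∪ σ '' tracePairs (2 * j + 1) n F := by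
    rw [hσ.image_eq_preimage_symm]
    ext ⟨s, t⟩
    simp only [Set.mem_prod, Set.mem_union, Set.mem_preimage, tracePairs, Set.mem_ofPred_eq, σ]
    constructor
    · rintro ⟨hs, ht⟩
      have hs2 := eval_S_sub_two_sq hs
      have ht2 := eval_S_sub_two_sq ht
      rw [e1] at hs
      rw [e2] at hs2
      rw [e1, e2, (hj s).1, (hj s).2]
      rcases sq_eq_sq_iff_eq_or_eq_neg.mp (hs2.trans ht2.symm) with h | h
      · exact Or.inl ⟨hs, ht, h⟩
      · exact Or.inr ⟨hs, ht, by rw [h, neg_neg]⟩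
    · rw [e1, (hj s).1]
      tauto
  have hdisj : Disjoint (tracePairs (2 * j + 1) n F) (σ '' tracePairs (2 * j + 1) n F) := by
    rw [hσ.image_eq_preimage_symm, Set.disjoint_left]
    rintro ⟨s, t⟩ ⟨hs, -, h⟩ ⟨-, -, h'⟩
    have hs2 := eval_S_sub_two_sq hs
    simp only [σ] at h'
    rw [e2, (hj s).2] at h'
    rw [e2] at h hs2
    simp only at h h' hs2
    have : 2 * (S F (2 * (j : ℤ) - 1)).eval s = 0 := by linear_combination h - h'
    rw [(mul_eq_zero.mp this).resolve_left h2] at hs2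
    simp at hs2
  rw [← Set.ncard_prod, hunion, Set.ncard_union_eq hdisj hfin (hfin.image σ),
    Set.ncard_image_of_injective _ hσ.injective, two_mul]

theorem encard_tracePairs (h2 : (2 : F) ≠ 0) (hm : m ≠ 0) (hn : n ≠ 0) (hmn : m.Coprime n) :
    (tracePairs m n F).encard = ({s | (S F ((m : ℤ) - 1)).eval s = 0}.ncard
      * {t | (S F ((n : ℤ) - 1)).eval t = 0}.ncard / 2 : ℕ) := by
  have key : 2 * (tracePairs m n F).ncard = {s | (S F ((m : ℤ) - 1)).eval s = 0}.ncard
      * {t | (S F ((n : ℤ) - 1)).eval t = 0}.ncard := by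
    rcases Nat.even_or_odd m with he | ho
    · have hno : Odd n := by
        by_contra hno
        have := Nat.dvd_gcd he.two_dvd (Nat.not_odd_iff_even.mp hno).two_dvd
        rw [hmn] at this
        omega
      rw [ncard_tracePairs_comm, two_mul_ncard_tracePairs_of_odd h2 hno hm, mul_comm]
    · exact two_mul_ncard_tracePairs_of_odd h2 ho hn
  rw [← key, Nat.mul_div_cancel_left _ two_pos, (finite_tracePairs hm hn).cast_ncard_eq]

/-- Reduction of the algebraic integers maps the trace pairs over `ℂ` onto those over `F`. -/
theorem exists_integral_tracePairs (h2 : (2 : F) ≠ 0) (hm : m ≠ 0) (hn : n ≠ 0)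
    (φ : integralClosure ℤ ℂ →+* F) {q : F × F} (hq : q ∈ tracePairs m n F) :
    ∃ s t : integralClosure ℤ ℂ, ((s : ℂ), (t : ℂ)) ∈ tracePairs m n ℂ ∧ (φ s, φ t) = q := by
  obtain ⟨s, hs, hs0⟩ := exists_integral_root_S φ hm hq.1
  obtain ⟨t, ht, ht0⟩ := exists_integral_root_S φ hn hq.2.1
  have hcoe : ∀ (i : ℤ) (x : integralClosure ℤ ℂ),
      (S ℂ i).eval (x : ℂ) = ((S (integralClosure ℤ ℂ) i).eval x : integralClosure ℤ ℂ) :=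
    eval_S_map (algebraMap (integralClosure ℤ ℂ) ℂ)
  refine ⟨s, t, ⟨?_, ?_, ?_⟩, Prod.ext hs ht⟩
  · simp only [hcoe, hs0, ZeroMemClass.coe_zero]
  · simp only [hcoe, ht0, ZeroMemClass.coe_zero]
  · simp only [hcoe]
    congr 1
    have hs2 := eval_S_sub_two_sq hs0
    have ht2 := eval_S_sub_two_sq ht0
    rcases sq_eq_sq_iff_eq_or_eq_neg.mp (hs2.trans ht2.symm) with h | h
    · exact h
    · exfalso
      have h' := hq.2.2
      rw [← hs, ← ht, eval_S_map φ, eval_S_map φ, h, map_neg] at h'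
      have h0 : φ ((S (integralClosure ℤ ℂ) ((n : ℤ) - 2)).eval t) = 0 := by
        have : 2 * φ ((S (integralClosure ℤ ℂ) ((n : ℤ) - 2)).eval t) = 0 := by
          linear_combination -h'
        exact (mul_eq_zero.mp this).resolve_left h2
      have := congrArg φ ht2
      rw [map_pow, h0, map_one] at this
      simp at this

theorem map_mem_tracePairs (φ : integralClosure ℤ ℂ →+* F) {s t : integralClosure ℤ ℂ}
    (h : ((s : ℂ), (t : ℂ)) ∈ tracePairs m n ℂ) : (φ s, φ t) ∈ tracePairs m n F := by
  have hcoe : ∀ (i : ℤ) (x : integralClosure ℤ ℂ),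
      (S ℂ i).eval (x : ℂ) = ((S (integralClosure ℤ ℂ) i).eval x : integralClosure ℤ ℂ) :=
    eval_S_map (algebraMap (integralClosure ℤ ℂ) ℂ)
  obtain ⟨h1, h3, h4⟩ := h
  simp only [hcoe] at h1 h3 h4
  refine ⟨?_, ?_, ?_⟩
  · simp only [eval_S_map φ, ZeroMemClass.coe_eq_zero.mp h1, map_zero]
  · simp only [eval_S_map φ, ZeroMemClass.coe_eq_zero.mp h3, map_zero]
  · simp only [eval_S_map φ, Subtype.ext h4]

theorem exists_integral_of_mem_tracePairs (hm : m ≠ 0) (hn : n ≠ 0) {q : ℂ × ℂ}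
    (hq : q ∈ tracePairs m n ℂ) : ∃ s t : integralClosure ℤ ℂ, q = ((s : ℂ), (t : ℂ)) := by
  have hint : ∀ {k : ℕ}, k ≠ 0 → ∀ {x : ℂ}, (S ℂ ((k : ℤ) - 1)).eval x = 0 → IsIntegral ℤ x := by
    intro k hk x hx
    rw [← map_S (algebraMap ℤ ℂ), Polynomial.eval_map] at hx
    exact ⟨_, monic_S_sub_one ℤ hk, hx⟩
  exact ⟨⟨q.1, hint hm hq.1⟩, ⟨q.2, hint hn hq.2.1⟩, rfl⟩

end TorusKnotGroup

/-! ### Existence of a reduction map, and the main theorem. -/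

/-- The residue field at a maximal ideal above `p` is algebraic over `ZMod p`, hence embeds in the
algebraically closed field `F`. -/
theorem nonempty_ringHom_integralClosure (p : ℕ) [Fact p.Prime] (F : Type*) [Field F]
    [IsAlgClosed F] [CharP F p] : Nonempty (integralClosure ℤ ℂ →+* F) := by
  have hmax : (Ideal.span {(p : ℤ)}).IsMaximal :=
    Int.ideal_span_isMaximal_of_prime p
  obtain ⟨Q, hQ, hQp⟩ := Ideal.exists_maximal_ideal_liesOver_of_isIntegral
    (S := integralClosure ℤ ℂ) (Ideal.span {(p : ℤ)})
  let _ : Field (integralClosure ℤ ℂ ⧸ Q) := Ideal.Quotient.field Q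
  have hpQ : ((p : ℕ) : integralClosure ℤ ℂ ⧸ Q) = 0 := by
    have : ((p : ℤ) : integralClosure ℤ ℂ) ∈ Q := by
      have h := (Ideal.mem_of_liesOver Q (Ideal.span {(p : ℤ)}) (p : ℤ)).mp
        (Ideal.mem_span_singleton_self _)
      simpa using h
    simpa using Ideal.Quotient.eq_zero_iff_mem.mpr this
  have : CharP (integralClosure ℤ ℂ ⧸ Q) p := (CharP.charP_iff_prime_eq_zero Fact.out).mpr hpQ
  let _ : Algebra (ZMod p) (integralClosure ℤ ℂ ⧸ Q) := ZMod.algebra _ p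
  let _ : Algebra (ZMod p) F := ZMod.algebra _ p
  have hint : Algebra.IsIntegral (ZMod p) (integralClosure ℤ ℂ ⧸ Q) := by
    have : Algebra.IsIntegral ℤ (integralClosure ℤ ℂ ⧸ Q) := inferInstance
    exact Algebra.IsIntegral.tower_top ℤ
  have : Algebra.IsAlgebraic (ZMod p) (integralClosure ℤ ℂ ⧸ Q) := inferInstance
  exact ⟨(IsAlgClosed.lift (R := ZMod p) (S := integralClosure ℤ ℂ ⧸ Q) (M := F)).toRingHom.comp
    (Ideal.Quotient.mk Q)⟩

open TorusKnotGroup in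
theorem mainTheorem6 {F : Type*} [Field F] [IsAlgClosed F]
    (p : ℕ) [Fact p.Prime] (hp : 2 < p) [CharP F p]
    (m n r n' : ℕ) (hmn : m.Coprime n) (hpn : p ∣ n) (hn : n = p ^ r * n')
    (hn' : n'.Coprime p) :
    (CharacterVariety.irrCharComponents (TorusKnotGroup m n) ℂ).encard
        = ((m - 1) * (n - 1) / 2 : ℕ) ∧
    (CharacterVariety.irrCharComponents (TorusKnotGroup m n) F).encard
        = ((m - 1) * (n' + 1) / 2 : ℕ) ∧
    Nonempty (integralClosure ℤ ℂ →+* F) ∧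
    ∀ φ : integralClosure ℤ ℂ →+* F,
      CharacterVariety.reduction φ '' CharacterVariety.irrCharComponents (TorusKnotGroup m n) ℂ
        = CharacterVariety.irrCharComponents (TorusKnotGroup m n) F := by
  have hprime : p.Prime := Fact.out
  have hcast : ∀ {k : ℕ}, k.Coprime p → (k : F) ≠ 0 := fun {k} hk h => by
    have := Nat.dvd_gcd ((CharP.cast_eq_zero_iff F p k).mp h) dvd_rfl
    rw [hk] at this
    exact hprime.one_lt.ne' (Nat.dvd_one.mp this)
  -- Since `p` divides only `n`, the polynomial `S (m - 1)` keeps `m - 1` distinct roots in `F`; all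
  -- collapsing is in the second trace.
  have hmp : m.Coprime p := hmn.coprime_dvd_right hpn
  have h2 : (2 : F) ≠ 0 := by
    have := hcast (k := 2) ((Nat.coprime_primes Nat.prime_two hprime).mpr hp.ne)
    exact_mod_cast this
  have hm0 : m ≠ 0 := by
    rintro rfl
    exact hcast hmp (by simp)
  have hn'0 : n' ≠ 0 := by
    rintro rfl
    exact hcast hn' (by simp)
  have hn0 : n ≠ 0 := by
    rw [hn]
    exact mul_ne_zero (pow_ne_zero r hprime.ne_zero) hn'0
  have hr : r ≠ 0 := by
    rintro rfl
    rw [pow_zero, one_mul] at hn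
    exact hcast hn' ((CharP.cast_eq_zero_iff F p n').mpr (hn ▸ hpn))
  refine ⟨?_, ?_, nonempty_ringHom_integralClosure p F, fun φ => ?_⟩
  · rw [encard_irrCharComponents hm0 hn0, encard_tracePairs two_ne_zero hm0 hn0 hmn,
      Polynomial.Chebyshev.ncard_roots_S two_ne_zero (Nat.cast_ne_zero.mpr hm0),
      Polynomial.Chebyshev.ncard_roots_S two_ne_zero (Nat.cast_ne_zero.mpr hn0)]
  · rw [encard_irrCharComponents hm0 hn0, encard_tracePairs h2 hm0 hn0 hmn,
      Polynomial.Chebyshev.ncard_roots_S h2 (hcast hmp), hn,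
      Polynomial.Chebyshev.ncard_roots_S_char_pow_mul h2 hr (hcast hn')]
  · rw [irrCharComponents_eq_image_traceLine hm0 hn0, irrCharComponents_eq_image_traceLine hm0 hn0]
    ext Z
    constructor
    · rintro ⟨_, ⟨q, hq, rfl⟩, rfl⟩
      obtain ⟨s, t, rfl⟩ := exists_integral_of_mem_tracePairs hm0 hn0 hq
      exact ⟨_, map_mem_tracePairs φ hq, (reduction_traceLine φ hq).symm⟩
    · rintro ⟨q, hq, rfl⟩
      obtain ⟨s, t, hst, rfl⟩ := exists_integral_tracePairs h2 hm0 hn0 φ hq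
      exact ⟨_, ⟨_, hst, rfl⟩, reduction_traceLine φ hst⟩
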